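/- For an infinite cardinal $\kappa$ (identified with the set of all ordinals below it), the weak diamond $\Phi_\kappa$ is the following statement: for every function $c:{}^{<\kappa}2\to 2$ there is $g\in{}^{\kappa}2$ such that for every $f\in{}^{\kappa}2$ the set $\{\alpha\in\kappa \mid c(f\upharpoonright\alpha)=g(\alpha)\}$ is stationary in $\kappa$, that is, it meets every closed unbounded subset of $\kappa$. Here ${}^{<\kappa}2$ is the set of all functions from some ordinal $\alpha<\kappa$ to $2=\{0,1\}$. Theorem. For every infinite cardinal $\kappa_0$ there is a cardinal $\kappa>\kappa_0$ such that $\Phi_\kappa$ holds. -/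

import Mathlib

universe u

/-- The weak diamond `Φ_κ` at a cardinal `κ`: for every `c : ^{<κ}2 → 2` there is `g ∈ ^κ2` such that
for every `f ∈ ^κ2` the set `{α ∈ κ | c (f ↾ α) = g α}` is stationary in `κ`.

The cardinal `κ` is the well-ordered type `κ.ord.ToType` of all ordinals below `κ`. For `α` in it,
the ordinal `α` is the initial segment `Set.Iio α`, so an element of `^{<κ}2` is an `α` together with
a function `Set.Iio α → Bool`. Stationary means meeting every closed unbounded subset of `κ`. -/
def WeakDiamond (κ : Cardinal.{u}) : Prop :=
  ∀ c : ((α : κ.ord.ToType) × (Set.Iio α → Bool)) → Bool,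
    ∃ g : κ.ord.ToType → Bool,
      ∀ f : κ.ord.ToType → Bool,
        IsStationary {α : κ.ord.ToType | c ⟨α, (Set.Iio α).domRestrict f⟩ = g α}

/-!
The argument is the Devlin–Shelah theorem, in the form: if `θ < κ` are infinite cardinals and
`2 ^ θ = 2 ^ μ < 2 ^ κ` for all `θ ≤ μ < κ`, then the weak diamond holds at `κ`. Given `θ = κ₀`, the least `κ` with
`2 ^ θ < 2 ^ κ` is as required, and it is larger than `θ`.

For such a `κ` there are `2 ^ θ` sequences of length `< κ` with values in `Y = {0, 1} ^ θ`, so each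
can be coded by one element of `Y` (`mk_sigma_Iio_le_of_forall_lt`). A function on `κ` is given by
its restrictions to the members of a cofinal set, so `2 ^ κ ≤ (2 ^ θ) ^ cof κ`. Hence
`θ < cof κ` (`mk_lt_cof_of_mk_sigma_le`), and intersections of `θ` clubs are clubs.

Suppose that the weak diamond fails, as witnessed by `c`. Then every `G : κ → 2` is *predicted* by
some `F : κ → 2`, in the sense that `c (F ↾ α) = G α` for a club of `α`. Treating `θ` coordinates at
once and intersecting `θ` clubs gives the same for functions `κ → Y`
(`exists_isClub_forall_pi_eq`). Starting with any `g : κ → 2`, one builds functions `f n : κ → Y` and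
decreasing clubs `C n` such that, for `α ∈ C (n + 1)`, the restriction `f (n + 1) ↾ α` determines
`f n ↾ β`, where `β` is the next element of `C n` after `α` (`IsCodingTower`). From the
restrictions `f n ↾ α` at one `α ∈ ⋂ n, C n` all of the `f n` can then be recovered, by climbing
along the common points of the clubs (`IsCodingTower.eq_of_eqOn`). Hence `g` is determined by
countably many elements of `Y`, which leaves only `2 ^ θ` possibilities for `g`, contradicting
`2 ^ θ < 2 ^ κ`.
-/

open Cardinal Set

/-! ### Restrictions to initial segments, and clubs in well-orders -/

theorem sigma_domRestrict_Iio_eq_iff {K Y : Type*} [Preorder K] {α β : K} {f g : K → Y} :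
    (⟨α, (Iio α).domRestrict f⟩ : (α : K) × (Iio α → Y)) = ⟨β, (Iio β).domRestrict g⟩ ↔
      α = β ∧ EqOn f g (Iio α) := by
  constructor
  · intro h
    obtain rfl : α = β := congrArg Sigma.fst h
    exact ⟨rfl, fun x hx => congrFun (eq_of_heq (Sigma.mk.inj h).2) ⟨x, hx⟩⟩
  · rintro ⟨rfl, h⟩
    congr 1
    funext x
    exact h x.2

theorem exists_isLeast_of_nonempty {K : Type*} [LinearOrder K] [WellFoundedLT K] {s : Set K}
    (hs : s.Nonempty) : ∃ a, IsLeast s a :=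
  ⟨wellFounded_lt.min s hs, wellFounded_lt.min_mem s hs,
    fun _ hb => not_lt.1 (wellFounded_lt.not_lt_min s hb)⟩

theorem exists_isLUB_of_bddAbove {K : Type*} [LinearOrder K] [WellFoundedLT K] {s : Set K}
    (hs : BddAbove s) : ∃ a, IsLUB s a :=
  exists_isLeast_of_nonempty hs

theorem IsClub.exists_isLeast_inter_Ioi {K : Type*} [LinearOrder K] [WellFoundedLT K]
    [NoMaxOrder K] {C : Set K} (hC : IsClub C) (α : K) : ∃ β, IsLeast (C ∩ Ioi α) β := by
  obtain ⟨γ, hγ⟩ := exists_gt α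
  obtain ⟨β, hβ, hγβ⟩ := hC.isCofinal γ
  exact exists_isLeast_of_nonempty ⟨β, hβ, hγ.trans_le hγβ⟩

/-! ### Coding towers -/

/-- A sequence of functions `f n : K → Y` with decreasing clubs `C n`, such that `p` recovers the
values of `f n` from those of `f (n + 1)`, and such that, for `α ∈ C (n + 1)`, the value of `d` at
the restriction of `f (n + 1)` to `Iio α` is the code, under `e`, of the restriction of `f n` to
`Iio β`, where `β` is the next element of `C n` after `α`. -/
structure IsCodingTower {K Y : Type*} [LinearOrder K] (p : Y → Y)
    (e d : ((α : K) × (Iio α → Y)) → Y) (f : ℕ → K → Y) (C : ℕ → Set K) : Prop where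
  isClub : ∀ n, IsClub (C n)
  succ_subset : ∀ n, C (n + 1) ⊆ C n
  proj : ∀ n x, p (f (n + 1) x) = f n x
  code : ∀ n, ∀ α ∈ C (n + 1), ∃ β, IsLeast (C n ∩ Ioi α) β ∧
    d ⟨α, (Iio α).domRestrict (f (n + 1))⟩ = e ⟨β, (Iio β).domRestrict (f n)⟩

namespace IsCodingTower

variable {K Y : Type*} [LinearOrder K] {p : Y → Y} {e d : ((α : K) × (Iio α → Y)) → Y}
  {f f' : ℕ → K → Y} {C C' : ℕ → Set K}

theorem apply_eq_of_le (h : IsCodingTower p e d f C) (h' : IsCodingTower p e d f' C') {m n : ℕ}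
    (hmn : m ≤ n) {x : K} (hx : f n x = f' n x) : f m x = f' m x := by
  induction n, hmn using Nat.le_induction with
  | base => exact hx
  | succ n _ ih => exact ih (by rw [← h.proj, ← h'.proj, hx])

theorem antitone (h : IsCodingTower p e d f C) : Antitone C :=
  antitone_nat_of_succ_le h.succ_subset

/-- If two towers agree below a common point `δ` of all their clubs, then they agree below a larger
such point: the supremum of the next elements of the clubs `C n` after `δ`. -/
theorem exists_gt_eqOn [WellFoundedLT K] [NoMaxOrder K]
    (h : IsCodingTower p e d f C) (h' : IsCodingTower p e d f' C') (he : Function.Injective e)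
    (hC : IsClub (⋂ n, C n)) {δ : K} (hδ : δ ∈ ⋂ n, C n) (hδ' : δ ∈ ⋂ n, C' n)
    (hf : ∀ n, EqOn (f n) (f' n) (Iio δ)) :
    ∃ γ > δ, γ ∈ ⋂ n, C n ∧ γ ∈ ⋂ n, C' n ∧ ∀ n, EqOn (f n) (f' n) (Iio γ) := by
  rw [mem_iInter] at hδ hδ'
  have key : ∀ n, ∃ β, IsLeast (C n ∩ Ioi δ) β ∧ IsLeast (C' n ∩ Ioi δ) β ∧
      EqOn (f n) (f' n) (Iio β) := by
    intro n
    obtain ⟨β, hβ, hc⟩ := h.code n δ (hδ _)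
    obtain ⟨β', hβ', hc'⟩ := h'.code n δ (hδ' _)
    rw [sigma_domRestrict_Iio_eq_iff.2 ⟨rfl, hf (n + 1)⟩, hc'] at hc
    obtain ⟨rfl, hE⟩ := sigma_domRestrict_Iio_eq_iff.1 (he hc)
    exact ⟨β', hβ, hβ', hE.symm⟩
  choose β hβ hβ' hE using key
  have hmono : Monotone β := monotone_nat_of_le_succ fun n =>
    (hβ n).2 ⟨h.succ_subset n (hβ (n + 1)).1.1, (hβ (n + 1)).1.2⟩
  -- The points `β n` are bounded by any common point of the clubs `C n` above `δ`.
  have hbdd : BddAbove (range β) := by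
    obtain ⟨ε, hε⟩ := hC.exists_isLeast_inter_Ioi δ
    refine ⟨ε, ?_⟩
    rintro _ ⟨n, rfl⟩
    exact (hβ n).2 ⟨mem_iInter.1 hε.1.1 n, hε.1.2⟩
  obtain ⟨γ, hγ⟩ := exists_isLUB_of_bddAbove hbdd
  have htail : ∀ n, IsLUB (range fun k => β (k + n)) γ := fun n =>
    ⟨by rintro _ ⟨k, rfl⟩; exact hγ.1 ⟨_, rfl⟩, fun b hb => hγ.2 <| by
      rintro _ ⟨k, rfl⟩
      exact (hmono (Nat.le_add_right k n)).trans (hb ⟨k, rfl⟩)⟩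
  refine ⟨γ, lt_of_lt_of_le (hβ 0).1.2 (hγ.1 ⟨0, rfl⟩), mem_iInter.2 fun n => ?_,
    mem_iInter.2 fun n => ?_, fun n x hx => ?_⟩
  · refine (h.isClub n).isLUB_mem ?_ (range_nonempty _) (htail n)
    rintro _ ⟨k, rfl⟩
    exact h.antitone (Nat.le_add_left n k) (hβ _).1.1
  · refine (h'.isClub n).isLUB_mem ?_ (range_nonempty _) (htail n)
    rintro _ ⟨k, rfl⟩
    exact h'.antitone (Nat.le_add_left n k) (hβ' _).1.1
  · obtain ⟨_, ⟨k, rfl⟩, hk⟩ := (lt_isLUB_iff (htail n)).1 hx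
    exact h.apply_eq_of_le h' (Nat.le_add_left n k) (hE _ hk)

/-- A tower is determined by its restrictions to `Iio α`, for one common point `α` of its clubs. -/
theorem eq_of_eqOn [WellFoundedLT K] [NoMaxOrder K]
    (h : IsCodingTower p e d f C) (h' : IsCodingTower p e d f' C') (he : Function.Injective e)
    (hC : IsClub (⋂ n, C n)) (hC' : IsClub (⋂ n, C' n)) {α : K} (hα : α ∈ ⋂ n, C n)
    (hα' : α ∈ ⋂ n, C' n) (hf : ∀ n, EqOn (f n) (f' n) (Iio α)) : f = f' := by
  let D : Set K := {δ | δ ∈ ⋂ n, C n ∧ δ ∈ ⋂ n, C' n ∧ ∀ n, EqOn (f n) (f' n) (Iio δ)}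
  have hD : D.Nonempty := ⟨α, hα, hα', hf⟩
  -- A bounded `D` would have a greatest element, since it is closed.
  have hunb : ¬ BddAbove D := by
    intro hb
    obtain ⟨δ, hδ⟩ := exists_isLUB_of_bddAbove hb
    have hδD : ∀ n, EqOn (f n) (f' n) (Iio δ) := by
      intro n x hx
      obtain ⟨ε, hε, hxε⟩ := (lt_isLUB_iff hδ).1 hx
      exact hε.2.2 n hxε
    obtain ⟨γ, hγ, hγD⟩ := h.exists_gt_eqOn h' he hC
      (hC.isLUB_mem (fun _ hx => hx.1) hD hδ) (hC'.isLUB_mem (fun _ hx => hx.2.1) hD hδ) hδD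
    exact hγ.not_ge (hδ.1 hγD)
  funext n x
  obtain ⟨δ, hδ, hxδ⟩ := not_bddAbove_iff.1 hunb x
  exact hδ.2.2 n hxδ

end IsCodingTower

/-! ### Predictions by a failure of the weak diamond -/

/-- If `c` predicts all functions with values in `Bool` on clubs, then, applied coordinatewise, it
predicts all functions with values in `I → Bool` on clubs. -/
theorem exists_isClub_forall_pi_eq {I K : Type u} [LinearOrder K] [WellFoundedLT K]
    {c : ((α : K) × (Iio α → Bool)) → Bool} (hcof : ℵ₀ < Order.cof K) (hI : #I < Order.cof K)
    (hc : ∀ g : K → Bool, ∃ (f : K → Bool) (C : Set K), IsClub C ∧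
      ∀ α ∈ C, c ⟨α, (Iio α).domRestrict f⟩ = g α)
    (G : K → I → Bool) : ∃ (F : K → I → Bool) (C : Set K), IsClub C ∧
      ∀ α ∈ C, (fun i => c ⟨α, fun x => F x i⟩) = G α := by
  choose f C hC hfC using fun i => hc fun α => G α i
  refine ⟨fun x i => f i x, ⋂ i, C i, IsClub.iInter hcof.ne' (by simpa using hI) hC, ?_⟩
  intro α hα
  funext i
  exact hfC i α (mem_iInter.1 hα i)

/-- If some `d` predicts all functions `K → Y` on clubs, then every function starts a coding tower.
The pairing function `q` serves to carry `f n` along inside `f (n + 1)`. -/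
theorem exists_isCodingTower {K Y : Type*} [LinearOrder K] [WellFoundedLT K] [NoMaxOrder K]
    (q : Y × Y ≃ Y) (e d : ((α : K) × (Iio α → Y)) → Y) (hcof : Order.cof K ≠ ℵ₀)
    (hd : ∀ G : K → Y, ∃ (F : K → Y) (C : Set K), IsClub C ∧
      ∀ α ∈ C, d ⟨α, (Iio α).domRestrict F⟩ = G α)
    (f₀ : K → Y) : ∃ (f : ℕ → K → Y) (C : ℕ → Set K), f 0 = f₀ ∧
      IsCodingTower (fun y => (q.symm y).1) e
        (fun s => d ⟨s.1, fun x => (q.symm (s.2 x)).2⟩) f C := by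
  have step : ∀ s : {s : (K → Y) × Set K // IsClub s.2}, ∃ t : {s : (K → Y) × Set K // IsClub s.2},
      t.1.2 ⊆ s.1.2 ∧ (∀ x, (q.symm (t.1.1 x)).1 = s.1.1 x) ∧
      ∀ α ∈ t.1.2, ∃ β, IsLeast (s.1.2 ∩ Ioi α) β ∧
        d ⟨α, fun x => (q.symm (t.1.1 x)).2⟩ = e ⟨β, (Iio β).domRestrict s.1.1⟩ := by
    rintro ⟨⟨f, C⟩, hC⟩
    choose β hβ using hC.exists_isLeast_inter_Ioi
    obtain ⟨F, D, hD, hF⟩ := hd fun α => e ⟨β α, (Iio (β α)).domRestrict f⟩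
    refine ⟨⟨(fun x => q (f x, F x), D ∩ C), hD.inter hcof hC⟩, inter_subset_right,
      fun x => by simp, fun α hα => ⟨β α, hβ α, ?_⟩⟩
    simpa using! hF α hα.1
  choose next h₁ h₂ h₃ using step
  let s : ℕ → {s : (K → Y) × Set K // IsClub s.2} := fun n => next^[n] ⟨(f₀, univ), .univ⟩
  have hs : ∀ n, s (n + 1) = next (s n) := fun n => Function.iterate_succ_apply' ..
  refine ⟨fun n => (s n).1.1, fun n => (s n).1.2, rfl, fun n => (s n).2, fun n => ?_, fun n x => ?_,
    fun n α hα => ?_⟩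
  · rw [hs]; exact h₁ _
  · simp only [hs]; exact h₂ _ x
  · simp only [hs] at hα ⊢; exact h₃ _ α hα

/-! ### Cardinal arithmetic -/

theorem mk_nat_pi_pi_bool (I : Type u) [Infinite I] : #(ℕ → I → Bool) = #(I → Bool) := by
  simp only [mk_pi, prod_const, mk_bool, mk_nat, lift_uzero, lift_aleph0, lift_ofNat,
    ← power_mul]
  rw [mul_aleph0_eq (aleph0_le_mk I)]

/-- A function on `K` is given by its restrictions to the members of a cofinal set. -/
theorem mk_pi_bool_le_power_cof {I K : Type u} [LinearOrder K] [NoMaxOrder K] [Nonempty I]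
    (hcode : #((α : K) × (Iio α → I → Bool)) ≤ #(I → Bool)) :
    #(K → Bool) ≤ #(I → Bool) ^ Order.cof K := by
  obtain ⟨S, hS, hcard⟩ := Order.exists_cof_eq K
  refine le_trans ?_ (power_le_power_right (c := Order.cof K) hcode)
  rw [← hcard, power_def]
  refine mk_le_of_injective (f := fun (g : K → Bool) (s : S) =>
    ⟨s.1, (Iio s.1).domRestrict fun x (_ : I) => g x⟩) fun g g' h => funext fun x => ?_
  obtain ⟨y, hy⟩ := exists_gt x
  obtain ⟨z, hz, hyz⟩ := hS y
  exact congrFun ((sigma_domRestrict_Iio_eq_iff.1 (congrFun h ⟨z, hz⟩)).2 (hy.trans_le hyz))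
    (Classical.arbitrary I)

theorem mk_lt_cof_of_mk_sigma_le {I K : Type u} [LinearOrder K] [NoMaxOrder K] [Infinite I]
    (hcode : #((α : K) × (Iio α → I → Bool)) ≤ #(I → Bool)) (hlt : #(I → Bool) < #(K → Bool)) :
    #I < Order.cof K := by
  by_contra! hle
  refine hlt.not_ge ((mk_pi_bool_le_power_cof hcode).trans ?_)
  refine (power_le_power_left (mk_ne_zero _) hle).trans ?_
  rw [show #(I → Bool) = 2 ^ #I by simp, ← power_mul, mul_eq_self (aleph0_le_mk I)]

/-- If `κ` is least with `2 ^ θ < 2 ^ κ`, then there are at most `2 ^ θ` sequences of length less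
than `κ` with values in a set of size `2 ^ θ`. -/
theorem mk_sigma_Iio_le_of_forall_lt {I : Type u} {κ : Cardinal.{u}} (hκ : ℵ₀ ≤ κ) (hI : #I < κ)
    (hmin : ∀ μ < κ, (2 : Cardinal.{u}) ^ μ ≤ 2 ^ #I) :
    #((α : κ.ord.ToType) × (Iio α → I → Bool)) ≤ #(I → Bool) := by
  have hY : #(I → Bool) = 2 ^ #I := by simp
  have hκY : κ ≤ 2 ^ #I := by
    by_contra! h
    exact (cantor _).not_ge (hmin _ h)
  rw [mk_sigma, hY]
  refine (sum_le_mk_mul_iSup _).trans ?_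
  have hsup : (⨆ α : κ.ord.ToType, #(Iio α → I → Bool)) ≤ 2 ^ #I := by
    refine ciSup_le' fun α => ?_
    rw [← power_def, hY, ← power_mul]
    have hα : #(Iio α) < κ := by simpa using mk_Iio_lt α (by simp)
    exact hmin _ (mul_lt_of_lt hκ hI hα)
  refine (mul_le_mul' ((mk_ord_toType κ).le.trans hκY) hsup).trans ?_
  rw [mul_eq_self (hκ.trans hκY)]

/-! ### The weak diamond -/

/-- The Devlin–Shelah theorem for a well-order `K`: the weak diamond follows if the bounded
sequences in `K` with values in `2 ^ I` can be coded by elements of `2 ^ I`, but the elements of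
`2 ^ K` cannot. -/
theorem exists_forall_isStationary {I K : Type u} [LinearOrder K] [WellFoundedLT K] [NoMaxOrder K]
    [Infinite I] (hcode : #((α : K) × (Iio α → I → Bool)) ≤ #(I → Bool))
    (hlt : #(I → Bool) < #(K → Bool)) (c : ((α : K) × (Iio α → Bool)) → Bool) :
    ∃ g : K → Bool, ∀ f : K → Bool,
      IsStationary {α : K | c ⟨α, (Iio α).domRestrict f⟩ = g α} := by
  by_contra! hneg
  have hI : #I < Order.cof K := mk_lt_cof_of_mk_sigma_le hcode hlt
  have hcof : ℵ₀ < Order.cof K := (aleph0_le_mk I).trans_lt hI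
  have : Nonempty K := Order.cof_ne_zero_iff.1 (aleph0_pos.trans hcof).ne'
  -- A function that guesses the complement of `g` on no club predicts `g` on some club.
  have hc : ∀ g : K → Bool, ∃ (f : K → Bool) (C : Set K), IsClub C ∧
      ∀ α ∈ C, c ⟨α, (Iio α).domRestrict f⟩ = g α := by
    intro g
    obtain ⟨f, hf⟩ := hneg fun α => !g α
    obtain ⟨C, hC, hdisj⟩ := not_isStationary_iff.1 hf
    refine ⟨f, C, hC, fun α hα => ?_⟩
    have : ¬ c ⟨α, (Iio α).domRestrict f⟩ = !g α := fun h => disjoint_left.1 hdisj h hα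
    simpa using! this
  obtain ⟨e⟩ := hcode
  obtain ⟨q⟩ : Nonempty ((I → Bool) × (I → Bool) ≃ (I → Bool)) := by
    rw [← Cardinal.eq, ← mul_def]
    exact mul_eq_self (aleph0_le_mk _)
  choose f C hf₀ hf using fun g : K → Bool => exists_isCodingTower q e
    (fun s i => c ⟨s.1, fun x => s.2 x i⟩) hcof.ne' (exists_isClub_forall_pi_eq hcof hI hc)
    (fun x _ => g x)
  have hC : ∀ g, IsClub (⋂ n, C g n) := fun g =>
    IsClub.iInter_of_countable hcof.ne' (hf g).isClub
  choose a ha using fun g => (hC g).nonempty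
  refine hlt.not_ge ?_
  rw [← mk_nat_pi_pi_bool I]
  refine mk_le_of_injective
    (f := fun (g : K → Bool) (n : ℕ) => e ⟨a g, (Iio (a g)).domRestrict (f g n)⟩) fun g g' h => ?_
  have h' := fun n => sigma_domRestrict_Iio_eq_iff.1 (e.injective (congrFun h n))
  have hfg : f g = f g' := (hf g).eq_of_eqOn (hf g') e.injective (hC g) (hC g') (ha g)
    ((h' 0).1 ▸ ha g') fun n => (h' n).2
  have h₀ : f g 0 = f g' 0 := by rw [hfg]
  rw [hf₀, hf₀] at h₀
  exact funext fun x => congrFun (congrFun h₀ x) (Classical.arbitrary I)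

theorem mainTheorem5 (κ₀ : Cardinal.{u}) (hκ₀ : Cardinal.aleph0 ≤ κ₀) :
    ∃ κ : Cardinal.{u}, κ₀ < κ ∧ WeakDiamond κ := by
  induction κ₀ using Cardinal.inductionOn with | _ I
  have : Infinite I := infinite_iff.2 hκ₀
  obtain ⟨κ, hκ, hmin⟩ := exists_isLeast_of_nonempty
    (s := {κ : Cardinal.{u} | (2 : Cardinal.{u}) ^ #I < 2 ^ κ}) ⟨2 ^ #I, cantor _⟩
  have hIκ : #I < κ := by
    by_contra! h
    exact (power_le_power_left two_ne_zero h).not_gt hκ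
  have hκ' : ℵ₀ ≤ κ := hκ₀.trans hIκ.le
  refine ⟨κ, hIκ, fun c => ?_⟩
  have : NoMaxOrder κ.ord.ToType := noMaxOrder hκ'
  refine exists_forall_isStationary (I := I) ?_ ?_ c
  · exact mk_sigma_Iio_le_of_forall_lt hκ' hIκ fun μ hμ => not_lt.1 fun h => hμ.not_ge (hmin h)
  · simpa using! hκ
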